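/- **Setting.** A fuzzy number is a function $\mu:\mathbb R\to[0,1]$ (membership function) that takes the value $1$, is quasi-concave and upper semicontinuous, and has bounded $\alpha$-cuts $\{\mu\ge\alpha\}$ for $\alpha\in(0,1]$; so each such cut is a compact interval $[\widetilde x^L_\alpha,\widetilde x^U_\alpha]$. Fuzzy numbers carry the $\sigma$-algebra generated by all the maps $\widetilde x\mapsto\widetilde x^L_\alpha$, $\widetilde x\mapsto\widetilde x^U_\alpha$, and $d$-tuples of them (fuzzy vectors) the product $\sigma$-algebra. Let $\widetilde{\mathcal X}$ be a set of fuzzy vectors of length $d$, $\widetilde{\mathcal D}$ a fuzzy distribution over it (the law of a fuzzy random vector, i.e. a probability measure on $\widetilde{\mathcal X}$), $f:\widetilde{\mathcal X}\to\{1,\dots,K\}$ a measurable ground truth and $M:\widetilde{\mathcal X}\to\mathbb R^d$ a measurable defuzzification function. "Fuzzy probability" of an event about a sample $\widetilde S_X=(\widetilde X_1,\dots,\widetilde X_m)$ of $m\ge1$ fuzzy vectors drawn i.i.d. from $\widetilde{\mathcal D}$ is its probability under $\widetilde{\mathcal D}^{\otimes m}$. Let $k:\mathbb R^d\times\mathbb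 R^d\to\mathbb R$ be a positive definite symmetric (PDS) kernel, with a (strongly) measurable feature map $\Phi:\mathbb R^d\to\mathbb H$ into a real Hilbert space, $\langle\Phi(x),\Phi(y)\rangle=k(x,y)$, and let $r>0$ be such that $k(M(\widetilde X),M(\widetilde X))\le r^2$ for all $\widetilde X\in\widetilde{\mathcal X}$. For $q\ge1$ and $\Lambda\ge0$ let $$\mathcal G_{k,q}=\Big\{g:x\mapsto(\langle w_1,\Phi(x)\rangle,\dots,\langle w_K,\Phi(x)\rangle)\ :\ w_1,\dots,w_K\in\mathbb H,\ \Big(\sum_{j=1}^K\|w_j\|_{\mathbb H}^q\Big)^{1/q}\le\Lambda\Big\}.$$ Let $l:\mathbb R^K\times\{1,\dots,K\}\to[0,\infty)$ be a loss and $C,C_l>0$, $L_l\ge0$ constants such that $\|g(M(\widetilde X))\|_\infty\le C$ for all $g\in\mathcal G_{k,q}$ and $\widetilde X\in\widetilde{\mathcal X}$, and such that on $\{t\in\mathbb R^K:\|t\|_\infty\le C\}$, for every $y$, $l(t,y)\le C_l$ and $t\mapsto l(t,y)$ is $L_l$-Lipschitz for the Euclidean norm. For $g\in\mathcal G_{k,q}$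 put $h=g\circ M$ and $$R(h)=\mathbb E_{\widetilde X\sim\widetilde{\mathcal D}}\big[l(h(\widetilde X),f(\widetilde X))\big],\qquad \widehat R(h)=\frac1m\sum_{i=1}^m l(h(\widetilde X_i),f(\widetilde X_i)).$$ **Theorem.** Let $\delta>0$ (for $\delta\ge1$ the claims are void) and $$B=2KL_l\sqrt{\frac{2r^2\Lambda^2}{m}}+C_l\sqrt{\frac{2\log(1/\delta)}{m}}.$$ If $2\delta^3\le1$ (that is, $\delta\le2^{-1/3}\approx0.79$), then with fuzzy probability at least $1-\delta$, for all $g\in\mathcal G_{k,q}$ and $h=g\circ M$, $$|R(h)-\widehat R(h)|\le B .$$ For every $\delta>0$, each of the two one-sided bounds "$R(h)-\widehat R(h)\le B$ for all such $h$" and "$\widehat R(h)-R(h)\le B$ for all such $h$" holds with fuzzy probability at least $1-\delta$. -/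

import Mathlib

open MeasureTheory

namespace MCIMO

/-- A (closed) fuzzy number: a fuzzy subset of `ℝ`, given by its membership function, which is
normal, convex (the membership function is quasi-concave), upper semicontinuous, and has bounded
`α`-cuts for every `α > 0`. -/
structure FuzzyNumber where
  /-- the membership function -/
  mem : ℝ → ℝ
  mem_nonneg : ∀ t, 0 ≤ mem t
  mem_le_one : ∀ t, mem t ≤ 1
  normal : ∃ t, mem t = 1
  quasiconcave : QuasiconcaveOn ℝ Set.univ mem
  upperSemicontinuous : UpperSemicontinuous mem
  bounded_cut : ∀ α : ℝ, 0 < α → Bornology.IsBounded {t | α ≤ mem t}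

namespace FuzzyNumber

/-- The `α`-cut of a fuzzy number. -/
def cut (a : FuzzyNumber) (α : ℝ) : Set ℝ := {t | α ≤ a.mem t}

/-- The left end point of the `α`-cut. -/
noncomputable def lower (a : FuzzyNumber) (α : ℝ) : ℝ := sInf (a.cut α)

/-- The right end point of the `α`-cut. -/
noncomputable def upper (a : FuzzyNumber) (α : ℝ) : ℝ := sSup (a.cut α)

/-- For `0 < α ≤ 1` the `α`-cut is the compact interval between its two end points. -/
theorem cut_eq_Icc (a : FuzzyNumber) {α : ℝ} (h0 : 0 < α) (h1 : α ≤ 1) :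
    a.cut α = Set.Icc (a.lower α) (a.upper α) := by
  have hne : (a.cut α).Nonempty := by
    obtain ⟨t, ht⟩ := a.normal
    exact ⟨t, by simpa [cut, ht] using h1⟩
  have hcl : IsClosed (a.cut α) := a.upperSemicontinuous.isClosed_preimage α
  have hbd : Bornology.IsBounded (a.cut α) := a.bounded_cut α h0
  have hconv : Convex ℝ (a.cut α) := by
    simpa [cut] using a.quasiconcave α
  have hconn : IsConnected (a.cut α) := ⟨hne, hconv.isPreconnected⟩
  exact eq_Icc_of_connected_compact hconn (Metric.isCompact_of_isClosed_isBounded hcl hbd)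

/-- The σ-algebra on fuzzy numbers generated by the end points of the `α`-cuts, `0 < α ≤ 1`. A map
into `FuzzyNumber` is measurable (a fuzzy random variable) iff the end points of all its `α`-cuts
are real random variables. -/
noncomputable instance instMeasurableSpace : MeasurableSpace FuzzyNumber :=
  ⨆ α ∈ Set.Ioc (0 : ℝ) 1,
    MeasurableSpace.comap (fun a : FuzzyNumber => a.lower α) inferInstance ⊔
      MeasurableSpace.comap (fun a : FuzzyNumber => a.upper α) inferInstance

end FuzzyNumber

/-- Fuzzy vectors: `d`-tuples of fuzzy numbers (with the product σ-algebra). -/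
abbrev FuzzyVector (d : ℕ) : Type := Fin d → FuzzyNumber

/-- A positive definite symmetric (PDS) kernel: it is symmetric, and
`∑ i j, c i * c j * k (x i) (x j) ≥ 0` for all finite families of points and coefficients. -/
def IsPDSKernel {E : Type*} (k : E → E → ℝ) : Prop :=
  (Matrix.of k).PosSemidef

/-- `Φ` is a feature map of the kernel `k`. -/
def IsFeatureMap {E H : Type*} [NormedAddCommGroup H] [InnerProductSpace ℝ H]
    (k : E → E → ℝ) (Φ : E → H) : Prop :=
  ∀ x y, inner ℝ (Φ x) (Φ y) = k x y

/-- The group norm `(∑ₖ ‖w k‖ ^ q) ^ (1 / q)` of a tuple of weight vectors. -/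
noncomputable def groupNorm {H : Type*} [NormedAddCommGroup H] {K : ℕ} (q : ℝ)
    (w : Fin K → H) : ℝ :=
  (∑ k, ‖w k‖ ^ q) ^ (1 / q)

/-- The family of kernel-based hypotheses `x ↦ (⟪w 1, Φ x⟫, …, ⟪w K, Φ x⟫)` with weights of group
norm at most `Λ`. -/
def kernelHypotheses {E H : Type*} [NormedAddCommGroup H] [InnerProductSpace ℝ H] (K : ℕ)
    (q Λ : ℝ) (Φ : E → H) : Set (E → EuclideanSpace ℝ (Fin K)) :=
  {g | ∃ w : Fin K → H, groupNorm q w ≤ Λ ∧ ∀ x k, g x k = inner ℝ (w k) (Φ x)}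

section Risk

variable {d K : ℕ} {𝒳 : Set (FuzzyVector d)}

/-- The risk `E_{X ∼ D} [l (h X, f X)]` of a hypothesis `h`, where `D` is the fuzzy distribution
(the law of a fuzzy random vector with values in the input space `𝒳`) and `f` the ground truth. -/
noncomputable def risk (D : Measure 𝒳) (l : EuclideanSpace ℝ (Fin K) → Fin K → ℝ)
    (f : 𝒳 → Fin K) (h : 𝒳 → EuclideanSpace ℝ (Fin K)) : ℝ :=
  ∫ x, l (h x) (f x) ∂D

/-- The empirical risk of `h` on a sample `S` of size `m`. -/
noncomputable def empiricalRisk {m : ℕ} (l : EuclideanSpace ℝ (Fin K) → Fin K → ℝ)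
    (f : 𝒳 → Fin K) (S : Fin m → 𝒳) (h : 𝒳 → EuclideanSpace ℝ (Fin K)) : ℝ :=
  (1 / (m : ℝ)) * ∑ i, l (h (S i)) (f (S i))

/-- The fuzzy probability of an event about a sample of `m` fuzzy vectors drawn i.i.d. from the
fuzzy distribution `D`. -/
noncomputable def fuzzyProb (D : Measure 𝒳) (m : ℕ) (A : Set (Fin m → 𝒳)) : ℝ :=
  (Measure.pi fun _ : Fin m => D).real A

end Risk

end MCIMO

namespace MCIMO

open ProbabilityTheory

/-! ### Splitting off the first coordinate of an i.i.d. sample. -/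

section Product

variable {X : Type*} [MeasurableSpace X]

/-! Let F be the supremum over hypotheses of m(R - R̂), a sum of centred losses over the sample.
Changing one sample point moves F by at most `C_l`, so McDiarmid's inequality
(`measureReal_ge_le_of_bounded_differences`) bounds how far F exceeds its mean. With the deviation
in the statement the tail is δ^4. A one-sided bound then needs only δ^4 ≤ δ, and the two-sided one
needs 2δ^4 ≤ δ, that is 2δ^3 ≤ 1.

The mean of F is compared with a Gaussian process. Symmetrization and a vector contraction
(`integral_ciSup_centred_le`, `ciSup_add_ciSup_sub_le`) replace an L-Lipschitz loss of h(x) by 2√2 L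
⟨ξ, h(x)⟩, with ξ standard Gaussian in ℝ^K. `integral_ciSup_sum_le` does this one sample coordinate
at a time. The new process is linear in the weights, so Cauchy-Schwarz in the Hilbert space and a
second moment computation bound it by 2√2 L K Λ √m r (`integral_ciSup_gaussian_le`).

These suprema run over finite families, which keeps them measurable and integrable.
`exists_separable_weights` and `measure_exists_deviation_le` extend the tail bound to the whole
class by density. -/

theorem measurePreserving_finCons (D : Measure X) [SigmaFinite D] (m : ℕ) :
    MeasurePreserving (fun p : X × (Fin m → X) => (Fin.cons p.1 p.2 : Fin (m + 1) → X))
      (D.prod (Measure.pi fun _ => D)) (Measure.pi fun _ => D) := by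
  have h := (measurePreserving_piFinSuccAbove (fun _ : Fin (m + 1) => D) 0).symm
  convert h using 1
  ext p : 1
  simp [MeasurableEquiv.piFinSuccAbove_symm_apply, Fin.insertNthEquiv]

theorem measurable_finCons (m : ℕ) :
    Measurable (fun p : X × (Fin m → X) => (Fin.cons p.1 p.2 : Fin (m + 1) → X)) := by
  refine measurable_pi_lambda _ fun i => ?_
  refine Fin.cases ?_ (fun j => ?_) i
  · exact measurable_fst
  · exact (measurable_pi_apply j).comp measurable_snd

theorem integrable_comp_finCons {D : Measure X} [SigmaFinite D] {m : ℕ}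
    {F : (Fin (m + 1) → X) → ℝ} (hF : Integrable F (Measure.pi fun _ => D)) :
    Integrable (fun p : X × (Fin m → X) => F (Fin.cons p.1 p.2))
      (D.prod (Measure.pi fun _ => D)) :=
  (measurePreserving_finCons D m).integrable_comp_of_integrable hF

theorem integral_comp_finCons {D : Measure X} [SigmaFinite D] {m : ℕ}
    {F : (Fin (m + 1) → X) → ℝ} (hF : Integrable F (Measure.pi fun _ => D)) :
    ∫ p : X × (Fin m → X), F (Fin.cons p.1 p.2) ∂(D.prod (Measure.pi fun _ => D)) =
      ∫ x, F x ∂(Measure.pi fun _ => D) := by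
  have h := measurePreserving_finCons D m
  rw [← h.map_eq, integral_map h.measurable.aemeasurable]
  rw [h.map_eq]
  exact hF.aestronglyMeasurable

/-- Fubini in the form used to run the inductions on the sample size. -/
theorem integral_pi_succ {D : Measure X} [SigmaFinite D] {m : ℕ}
    {F : (Fin (m + 1) → X) → ℝ} (hF : Integrable F (Measure.pi fun _ => D)) :
    ∫ x, F x ∂(Measure.pi fun _ => D) =
      ∫ x, ∫ y, F (Fin.cons x y) ∂(Measure.pi fun _ : Fin m => D) ∂D := by
  rw [← integral_comp_finCons hF, integral_prod _ (integrable_comp_finCons hF)]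

end Product

/-! ### Bounded differences inequality. -/

section McDiarmid

variable {X : Type*} [MeasurableSpace X]

/-- A measurable function whose values differ by at most `c` is, once centred, sub-Gaussian. -/
theorem hasSubgaussianMGF_of_oscillation {D : Measure X} [IsProbabilityMeasure D] {G : X → ℝ}
    (hG : Measurable G) {c : NNReal} (hc : ∀ x y, G x - G y ≤ c) :
    HasSubgaussianMGF (fun x => G x - ∫ y, G y ∂D) ((c / 2) ^ 2) D := by
  obtain ⟨x₀⟩ : Nonempty X := nonempty_of_isProbabilityMeasure D
  have hbdd : BddBelow (Set.range G) := ⟨G x₀ - c, by rintro _ ⟨x, rfl⟩; linarith [hc x₀ x]⟩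
  have : Nonempty X := ⟨x₀⟩
  -- The values of `G` lie in an interval of length `c` starting at its infimum, so Hoeffding's
  -- lemma applies.
  have h := hasSubgaussianMGF_of_mem_Icc (μ := D) (X := G) (a := ⨅ x, G x) (b := (⨅ x, G x) + c)
    hG.aemeasurable (Filter.Eventually.of_forall fun x => ⟨ciInf_le hbdd x, by
      have : G x - c ≤ ⨅ y, G y := le_ciInf fun y => by linarith [hc x y]
      linarith⟩)
  simpa using h

/-- The bounded differences inequality (McDiarmid), in its moment generating function form. -/
theorem integral_exp_sub_integral_le {D : Measure X} [IsProbabilityMeasure D] {c : NNReal} (s : ℝ) :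
    ∀ {m : ℕ} {F : (Fin m → X) → ℝ}, Measurable F → (∃ A, ∀ S, |F S| ≤ A) →
      (∀ S i x y, F (Function.update S i x) - F (Function.update S i y) ≤ c) →
      ∫ S, Real.exp (s * (F S - ∫ T, F T ∂(Measure.pi fun _ => D))) ∂(Measure.pi fun _ => D)
        ≤ Real.exp ((m * (c / 2) ^ 2 : ℝ) * s ^ 2 / 2) := by
  intro m
  induction m with
  | zero =>
    intro F _ _ _
    simp [integral_unique, measureReal_def]
  | succ m ih =>
    rintro F hF ⟨A, hA⟩ hd
    have hFi : Integrable F (Measure.pi fun _ => D) :=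
      Integrable.of_bound hF.aestronglyMeasurable A (Filter.Eventually.of_forall hA)
    have hFc := hF.comp (measurable_finCons (X := X) m)
    have hFx : ∀ x, Measurable fun y => F (Fin.cons x y) := fun x =>
      hFc.comp measurable_prodMk_left
    have hFxi : ∀ x, Integrable (fun y => F (Fin.cons x y)) (Measure.pi fun _ : Fin m => D) :=
      fun x => Integrable.of_bound (hFx x).aestronglyMeasurable A
        (Filter.Eventually.of_forall fun y => hA _)
    -- First step of the Doob martingale: `G x` is the mean given the first coordinate. It inherits
    -- the oscillation bound `c`, while the induction hypothesis handles the fluctuation of `F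
    -- (Fin.cons x ·)` around `G x`.
    set G : X → ℝ := fun x => ∫ y, F (Fin.cons x y) ∂(Measure.pi fun _ : Fin m => D) with hG
    have hGm : Measurable G :=
      (StronglyMeasurable.integral_prod_right
        (f := fun x (y : Fin m → X) => F (Fin.cons x y)) hFc.stronglyMeasurable).measurable
    have hGosc : ∀ x x', G x - G x' ≤ c := by
      intro x x'
      rw [hG, ← integral_sub (hFxi x) (hFxi x')]
      calc _ ≤ ∫ _, (c : ℝ) ∂(Measure.pi fun _ : Fin m => D) := by
            refine integral_mono ((hFxi x).sub (hFxi x')) (integrable_const _) fun y => ?_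
            have := hd (Fin.cons x y) 0 x x'
            simpa using this
        _ = c := by simp
    have hEF : ∫ T, F T ∂(Measure.pi fun _ => D) = ∫ x, G x ∂D := integral_pi_succ hFi
    set e := ∫ x, G x ∂D
    have hint : Integrable (fun S => Real.exp (s * (F S - e))) (Measure.pi fun _ => D) := by
      refine Integrable.of_bound (by fun_prop) (Real.exp (|s| * (A + |e|)))
        (Filter.Eventually.of_forall fun S => ?_)
      rw [Real.norm_eq_abs, Real.abs_exp]
      refine Real.exp_le_exp.2 ((le_abs_self _).trans ?_)
      rw [abs_mul]
      gcongr
      exact (abs_sub _ _).trans (by gcongr; exact hA S)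
    have hsub := hasSubgaussianMGF_of_oscillation (D := D) hGm hGosc
    rw [hEF, integral_pi_succ hint]
    have hinner : ∀ x, ∫ y, Real.exp (s * (F (Fin.cons x y) - e)) ∂(Measure.pi fun _ : Fin m => D)
        ≤ Real.exp ((m * (c / 2) ^ 2 : ℝ) * s ^ 2 / 2) * Real.exp (s * (G x - e)) := by
      intro x
      have := ih (hFx x) ⟨A, fun S => hA _⟩ (fun S i y z => by
        have := hd (Fin.cons x S) i.succ y z
        simpa [← Fin.cons_update] using this)
      calc _ = (∫ y, Real.exp (s * (F (Fin.cons x y) - G x)) ∂(Measure.pi fun _ : Fin m => D)) *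
            Real.exp (s * (G x - e)) := by
            rw [← integral_mul_const]
            congr 1; ext y; rw [← Real.exp_add]; congr 1; ring
        _ ≤ _ := by gcongr
    calc _ ≤ ∫ x, Real.exp ((m * (c / 2) ^ 2 : ℝ) * s ^ 2 / 2) * Real.exp (s * (G x - e)) ∂D :=
          integral_mono (integrable_comp_finCons hint).integral_prod_left
            ((hsub.integrable_exp_mul s).const_mul _) hinner
      _ ≤ Real.exp ((m * (c / 2) ^ 2 : ℝ) * s ^ 2 / 2) *
            Real.exp ((c / 2) ^ 2 * s ^ 2 / 2) := by
          rw [integral_const_mul]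
          gcongr
          exact_mod_cast hsub.mgf_le s
      _ = _ := by
          rw [← Real.exp_add]; congr 1; push_cast; ring

/-- The bounded differences inequality (McDiarmid). -/
theorem measureReal_ge_le_of_bounded_differences {D : Measure X} [IsProbabilityMeasure D]
    {c : NNReal} {m : ℕ} {F : (Fin m → X) → ℝ} (hF : Measurable F) (hA : ∃ A, ∀ S, |F S| ≤ A)
    (hd : ∀ S i x y, F (Function.update S i x) - F (Function.update S i y) ≤ c) {t : ℝ}
    (ht : 0 ≤ t) :
    (Measure.pi fun _ => D).real {S | (∫ T, F T ∂(Measure.pi fun _ => D)) + t ≤ F S} ≤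
      Real.exp (-t ^ 2 / (2 * (m * (c / 2) ^ 2))) := by
  have h : HasSubgaussianMGF (fun S => F S - ∫ T, F T ∂(Measure.pi fun _ => D))
      (m * (c / 2) ^ 2) (Measure.pi fun _ => D) := by
    obtain ⟨A, hA'⟩ := hA
    refine ⟨fun s => ?_, fun s => ?_⟩
    · refine integrable_exp_mul_of_mem_Icc (a := -A - ∫ T, F T ∂(Measure.pi fun _ => D))
        (b := A - ∫ T, F T ∂(Measure.pi fun _ => D)) (by fun_prop)
        (Filter.Eventually.of_forall fun S => ?_)
      have := abs_le.1 (hA' S)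
      constructor <;> linarith
    · have := integral_exp_sub_integral_le (D := D) s hF ⟨A, hA'⟩ hd
      exact_mod_cast this
  have := h.measure_ge_le ht
  convert this using 3
  · ext S; rw [le_sub_iff_add_le, add_comm]
  · push_cast; rfl

end McDiarmid

/-! ### Finite suprema and coordinate-by-coordinate comparison. -/

section Comparison

variable {ι X Z : Type*} [Finite ι] [MeasurableSpace X] [MeasurableSpace Z]

theorem le_finite_ciSup (f : ι → ℝ) (w : ι) : f w ≤ ⨆ v, f v :=
  le_ciSup (Set.finite_range f).bddAbove w

theorem integrable_finite_ciSup [Nonempty ι] {μ : Measure X} {F : ι → X → ℝ}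
    (hF : ∀ w, Integrable (F w) μ) : Integrable (fun x => ⨆ w, F w x) μ := by
  have := Fintype.ofFinite ι
  refine Integrable.mono' (g := fun x => ∑ w, |F w x|)
    (integrable_finsetSum _ fun w _ => (hF w).abs) ?_ (Filter.Eventually.of_forall fun x => ?_)
  · exact (AEMeasurable.iSup fun w => (hF w).aemeasurable).aestronglyMeasurable
  · obtain ⟨w, hw⟩ := exists_eq_ciSup_of_finite (f := fun w => F w x)
    rw [← hw, Real.norm_eq_abs]
    exact Finset.single_le_sum (f := fun w => |F w x|) (fun _ _ => abs_nonneg _)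
      (Finset.mem_univ w)

theorem integrable_sum_eval {D : Measure X} [IsProbabilityMeasure D] {b : X → ℝ}
    (hb : Integrable b D) (m : ℕ) :
    Integrable (fun S : Fin m → X => ∑ i, b (S i)) (Measure.pi fun _ => D) :=
  integrable_finsetSum _ fun i _ =>
    (measurePreserving_eval (fun _ : Fin m => D) i).integrable_comp_of_integrable hb

/-- An inequality between expected suprema with one independent coordinate, uniform in a
deterministic offset `g`, extends to sums over `m` independent coordinates. -/
theorem integral_ciSup_sum_le [Nonempty ι] {D : Measure X} [IsProbabilityMeasure D]
    {ρ : Measure Z} [IsProbabilityMeasure ρ] {b : ι → X → ℝ} {a : ι → Z → ℝ}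
    (hb : ∀ w, Integrable (b w) D) (ha : ∀ w, Integrable (a w) ρ)
    (hstep : ∀ g : ι → ℝ, ∫ x, ⨆ w, (g w + b w x) ∂D ≤ ∫ z, ⨆ w, (g w + a w z) ∂ρ) (m : ℕ) :
    ∀ g : ι → ℝ,
      ∫ S, ⨆ w, (g w + ∑ i, b w (S i)) ∂(Measure.pi fun _ : Fin m => D) ≤
        ∫ T, ⨆ w, (g w + ∑ i, a w (T i)) ∂(Measure.pi fun _ : Fin m => ρ) := by
  induction m with
  | zero => intro g; simp [integral_unique, measureReal_def]
  | succ m ih =>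
    intro g
    have hB : Integrable (fun S => ⨆ w, (g w + ∑ i, b w (S i)))
        (Measure.pi fun _ : Fin (m + 1) => D) :=
      integrable_finite_ciSup fun w => (integrable_const _).add (integrable_sum_eval (hb w) _)
    have hA : Integrable (fun S => ⨆ w, (g w + ∑ i, a w (S i)))
        (Measure.pi fun _ : Fin (m + 1) => ρ) :=
      integrable_finite_ciSup fun w => (integrable_const _).add (integrable_sum_eval (ha w) _)
    have hB' := integrable_comp_finCons hB
    have hA' := integrable_comp_finCons hA
    rw [integral_pi_succ hB, ← integral_comp_finCons hA, integral_prod_symm _ hA']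
    simp only [Fin.sum_univ_succ, Fin.cons_zero, Fin.cons_succ, ← add_assoc] at hB' hA' ⊢
    have hmix : Integrable (fun p : X × (Fin m → Z) => ⨆ w, (g w + b w p.1 + ∑ i, a w (p.2 i)))
        (D.prod (Measure.pi fun _ : Fin m => ρ)) :=
      integrable_finite_ciSup fun w => ((integrable_const _).add ((hb w).comp_fst _)).add
        ((integrable_sum_eval (ha w) m).comp_snd _)
    -- With `x` frozen, `b w x` joins the offset and the induction hypothesis exchanges the other
    -- coordinates. After swapping integrals, their sum becomes the offset in `hstep`, which
    -- exchanges the remaining one.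
    calc _ ≤ ∫ x, ∫ T, ⨆ w, (g w + b w x + ∑ i, a w (T i)) ∂(Measure.pi fun _ : Fin m => ρ) ∂D :=
          integral_mono hB'.integral_prod_left hmix.integral_prod_left
            fun x => ih fun w => g w + b w x
      _ = ∫ T, ∫ x, ⨆ w, (g w + b w x + ∑ i, a w (T i)) ∂D ∂(Measure.pi fun _ : Fin m => ρ) := by
          rw [← integral_prod _ hmix, integral_prod_symm _ hmix]
      _ ≤ _ := by
          refine integral_mono hmix.integral_prod_right hA'.integral_prod_right fun T => ?_
          have := hstep fun w => g w + ∑ i, a w (T i)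
          simpa only [add_right_comm] using this

end Comparison

/-! ### Moments and symmetry of the standard Gaussian. -/

section Gaussian

/-- The integrand depends only on |x|, which leaves a Gamma integral over the half line. -/
theorem integral_abs_gaussianReal :
    ∫ x, |x| ∂(gaussianReal 0 1) = √(2 / Real.pi) := by
  rw [integral_gaussianReal_eq_integral_smul one_ne_zero]
  have h1 : ∀ x : ℝ, gaussianPDFReal 0 1 x • |x| =
      (fun y : ℝ => (√(2 * Real.pi))⁻¹ * (y ^ (1 : ℝ) * Real.exp (-(1 / 2) * y ^ (2 : ℝ)))) |x| := by
    intro x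
    simp only [gaussianPDFReal, smul_eq_mul, NNReal.coe_one, mul_one, sub_zero, Real.rpow_one]
    rw [Real.rpow_two, sq_abs]
    ring_nf
  simp_rw [h1]
  rw [integral_comp_abs (f := fun y : ℝ =>
    (√(2 * Real.pi))⁻¹ * (y ^ (1 : ℝ) * Real.exp (-(1 / 2) * y ^ (2 : ℝ)))), integral_const_mul,
    integral_rpow_mul_exp_neg_mul_rpow (by norm_num) (by norm_num) (by norm_num)]
  norm_num
  have : √2 * √2 = 2 := Real.mul_self_sqrt (by norm_num)
  field_simp
  nlinarith

variable {E : Type*} [NormedAddCommGroup E] [InnerProductSpace ℝ E] [FiniteDimensional ℝ E]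
  [MeasurableSpace E] [BorelSpace E]

theorem integrable_inner_stdGaussian (v : E) :
    Integrable (fun ξ : E => inner ℝ ξ v) (stdGaussian E) := by
  have := IsGaussian.integrable_dual (stdGaussian E) (innerSL ℝ v)
  simpa [real_inner_comm] using this

theorem integral_inner_stdGaussian (v : E) : ∫ ξ, inner ℝ ξ v ∂(stdGaussian E) = 0 := by
  have := integral_strongDual_stdGaussian (innerSL ℝ v)
  simpa [real_inner_comm] using this

theorem map_inner_stdGaussian (v : E) :
    (stdGaussian E).map (fun ξ => inner ℝ ξ v) = gaussianReal 0 (‖v‖₊ ^ 2) := by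
  have h := IsGaussian.map_eq_gaussianReal (μ := stdGaussian E) (innerSL ℝ v)
  rw [integral_strongDual_stdGaussian, variance_dual_stdGaussian, innerSL_apply_norm] at h
  convert h using 2
  · ext ξ; simp [real_inner_comm]
  · ext; simp

theorem integral_inner_sq_stdGaussian (v : E) :
    ∫ ξ, inner ℝ ξ v ^ 2 ∂(stdGaussian E) = ‖v‖ ^ 2 := by
  have h := variance_dual_stdGaussian (innerSL ℝ v)
  rw [variance_of_integral_eq_zero (by fun_prop) (integral_strongDual_stdGaussian _),
    innerSL_apply_norm] at h
  simpa [real_inner_comm] using h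

theorem integrable_inner_sq_stdGaussian (v : E) :
    Integrable (fun ξ : E => inner ℝ ξ v ^ 2) (stdGaussian E) := by
  have := (IsGaussian.memLp_dual (stdGaussian E) (innerSL ℝ v) 2 (by simp)).integrable_sq
  simpa [real_inner_comm] using this

theorem integral_abs_inner_stdGaussian (v : E) :
    ∫ ξ, |inner ℝ ξ v| ∂(stdGaussian E) = √(2 / Real.pi) * ‖v‖ := by
  have h1 : ∫ ξ, |inner ℝ ξ v| ∂(stdGaussian E) = ∫ x, |x| ∂(gaussianReal 0 (‖v‖₊ ^ 2)) := by
    rw [← map_inner_stdGaussian, integral_map (by fun_prop) (by fun_prop)]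
  have h2 : gaussianReal 0 (‖v‖₊ ^ 2) = (gaussianReal 0 1).map (fun x => ‖v‖ * x) := by
    rw [gaussianReal_map_const_mul]
    congr 1
    · simp
    · ext; simp
  rw [h1, h2, integral_map (by fun_prop) (by fun_prop)]
  simp_rw [abs_mul, abs_norm]
  rw [integral_const_mul, integral_abs_gaussianReal, mul_comm]

/-- Here √2 · √(2/π) = 2/√π ≥ 1 because π < 4. This is the source of the √2 in the contraction. -/
theorem norm_le_integral_abs_inner_stdGaussian (v : E) :
    ‖v‖ ≤ √2 * ∫ ξ, |inner ℝ ξ v| ∂(stdGaussian E) := by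
  rw [integral_abs_inner_stdGaussian, ← mul_assoc, ← Real.sqrt_mul (by norm_num)]
  refine le_mul_of_one_le_left (norm_nonneg _) (Real.one_le_sqrt.2 ?_)
  rw [← mul_div_assoc, le_div_iff₀ Real.pi_pos]
  linarith [Real.pi_lt_four]

theorem integral_comp_neg_stdGaussian (F : E → ℝ) :
    ∫ ξ, F (-ξ) ∂(stdGaussian E) = ∫ ξ, F ξ ∂(stdGaussian E) := by
  have h := stdGaussian_map (LinearIsometryEquiv.neg ℝ (E := E))
  conv_rhs => rw [← h]
  exact ((LinearIsometryEquiv.neg ℝ (E := E)).toHomeomorph.measurableEmbedding.integral_map F).symm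

end Gaussian

/-! ### Symmetrization and vector contraction. -/

section Contraction

variable {ι : Type*} [Finite ι] [Nonempty ι]
variable {E : Type*} [NormedAddCommGroup E] [InnerProductSpace ℝ E] [FiniteDimensional ℝ E]
  [MeasurableSpace E] [BorelSpace E]

/-- The vector contraction principle for one Rademacher variable, with Gaussian comparison. -/
theorem ciSup_add_ciSup_sub_le (g p : ι → ℝ) (u : ι → E) {L : ℝ} (hL : 0 ≤ L)
    (hp : ∀ w v, p w - p v ≤ L * ‖u w - u v‖) :
    ((⨆ w, (g w + p w)) + ⨆ w, (g w - p w)) / 2 ≤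
      ∫ ξ, ⨆ w, (g w + √2 * L * inner ℝ ξ (u w)) ∂(stdGaussian E) := by
  set Ψ : E → ℝ := fun ξ => ⨆ w, (g w + √2 * L * inner ℝ ξ (u w)) with hΨ
  have hΨi : Integrable Ψ (stdGaussian E) := integrable_finite_ciSup fun w =>
    (integrable_const _).add ((integrable_inner_stdGaussian (u w)).const_mul _)
  have hΨi' : Integrable (fun ξ => Ψ (-ξ)) (stdGaussian E) := by
    have : Integrable (fun ξ => ⨆ w, (g w + -(√2 * L) * inner ℝ ξ (u w))) (stdGaussian E) :=
      integrable_finite_ciSup fun w =>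
        (integrable_const _).add ((integrable_inner_stdGaussian (u w)).const_mul _)
    simpa [hΨ] using this
  -- Both suprema are attained, so only the increment `p w₁ - p w₂` matters, and the Lipschitz
  -- hypothesis bounds it.
  obtain ⟨w₁, h₁⟩ := exists_eq_ciSup_of_finite (f := fun w => g w + p w)
  obtain ⟨w₂, h₂⟩ := exists_eq_ciSup_of_finite (f := fun w => g w - p w)
  rw [← h₁, ← h₂]
  have hi := (integrable_inner_stdGaussian (u w₁ - u w₂)).abs.const_mul (√2 * L)
  have key : ∫ ξ, (g w₁ + g w₂ + √2 * L * |inner ℝ ξ (u w₁ - u w₂)|) ∂(stdGaussian E) ≤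
      ∫ ξ, (Ψ ξ + Ψ (-ξ)) ∂(stdGaussian E) := by
    refine integral_mono ((integrable_const _).add hi) (hΨi.add hΨi') fun ξ => ?_
    have a₁ := le_finite_ciSup (fun w => g w + √2 * L * inner ℝ ξ (u w)) w₁
    have a₂ := le_finite_ciSup (fun w => g w + √2 * L * inner ℝ ξ (u w)) w₂
    have b₁ := le_finite_ciSup (fun w => g w + √2 * L * inner ℝ (-ξ) (u w)) w₁
    have b₂ := le_finite_ciSup (fun w => g w + √2 * L * inner ℝ (-ξ) (u w)) w₂
    simp only [hΨ]
    simp only [inner_neg_left] at b₁ b₂ ⊢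
    -- The sign of the inner product decides which of `w₁`, `w₂` is tested at `ξ` and which at `-ξ`;
    -- this produces the absolute value.
    rcases abs_cases (inner ℝ ξ (u w₁ - u w₂)) with ⟨h, _⟩ | ⟨h, _⟩ <;>
      rw [h, inner_sub_right] <;> linarith
  rw [integral_add hΨi hΨi', integral_comp_neg_stdGaussian Ψ,
    integral_add (integrable_const _) hi, integral_const_mul] at key
  simp only [integral_const, probReal_univ, one_smul] at key
  have hn := mul_le_mul_of_nonneg_left (norm_le_integral_abs_inner_stdGaussian (u w₁ - u w₂)) hL
  have := hp w₁ w₂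
  linarith

variable {X : Type*} [MeasurableSpace X]

/-- Symmetrization and contraction for one coordinate of the sample. -/
theorem integral_ciSup_centred_le {D : Measure X} [IsProbabilityMeasure D] {φ : ι → X → ℝ}
    (hφ : ∀ w, Integrable (φ w) D) {h : ι → X → E} {L : ℝ} (hL : 0 ≤ L)
    (hlip : ∀ w v x, φ w x - φ v x ≤ L * ‖h w x - h v x‖)
    (hint : ∀ w, Integrable (fun z : X × E => (inner ℝ z.2 (h w z.1) : ℝ))
      (D.prod (stdGaussian E))) (g : ι → ℝ) :
    ∫ x, ⨆ w, (g w + (∫ y, φ w y ∂D - φ w x)) ∂D ≤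
      ∫ z, ⨆ w, (g w + √2 * (2 * L) * inner ℝ z.2 (h w z.1)) ∂(D.prod (stdGaussian E)) := by
  have hplus : Integrable (fun x => ⨆ w, (g w + 2 * φ w x)) D :=
    integrable_finite_ciSup fun w => (integrable_const _).add ((hφ w).const_mul _)
  have hminus : Integrable (fun x => ⨆ w, (g w - 2 * φ w x)) D :=
    integrable_finite_ciSup fun w => (integrable_const _).sub ((hφ w).const_mul _)
  have hZ : Integrable (fun z : X × E => ⨆ w, (g w + √2 * (2 * L) * inner ℝ z.2 (h w z.1)))
      (D.prod (stdGaussian E)) :=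
    integrable_finite_ciSup fun w => (integrable_const _).add ((hint w).const_mul _)
  -- Write g + Eφ - φ(x) as the average of g + 2Eφ and g - 2φ(x). The doubled loss is what turns `L`
  -- into `2 * L`.
  have hcentred : ∀ x, ⨆ w, (g w + (∫ y, φ w y ∂D - φ w x)) ≤
      (∫ y, ⨆ w, (g w + 2 * φ w y) ∂D) / 2 + (⨆ w, (g w - 2 * φ w x)) / 2 := by
    intro x
    refine ciSup_le fun w => ?_
    have h1 : ∫ y, (g w + 2 * φ w y) ∂D ≤ ∫ y, ⨆ w, (g w + 2 * φ w y) ∂D :=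
      integral_mono ((integrable_const _).add ((hφ w).const_mul _)) hplus
        fun y => le_finite_ciSup (fun w => g w + 2 * φ w y) w
    rw [integral_add (integrable_const _) ((hφ w).const_mul _), integral_const_mul] at h1
    simp only [integral_const, probReal_univ, one_smul] at h1
    have h2 := le_finite_ciSup (fun w => g w - 2 * φ w x) w
    linarith
  calc _ ≤ ∫ x, ((∫ y, ⨆ w, (g w + 2 * φ w y) ∂D) / 2 + (⨆ w, (g w - 2 * φ w x)) / 2) ∂D :=
        integral_mono (integrable_finite_ciSup fun w =>
            (integrable_const _).add ((integrable_const _).sub (hφ w)))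
          ((integrable_const _).add (hminus.div_const _)) hcentred
    _ = ∫ x, ((⨆ w, (g w + 2 * φ w x)) + ⨆ w, (g w - 2 * φ w x)) / 2 ∂D := by
        rw [integral_add (integrable_const _) (hminus.div_const _)]
        simp_rw [add_div]
        rw [integral_add (hplus.div_const _) (hminus.div_const _)]
        simp [integral_div]
    _ ≤ ∫ x, ∫ ξ, ⨆ w, (g w + √2 * (2 * L) * inner ℝ ξ (h w x)) ∂(stdGaussian E) ∂D := by
        refine integral_mono ((hplus.add hminus).div_const 2) hZ.integral_prod_left fun x => ?_
        exact ciSup_add_ciSup_sub_le g (fun w => 2 * φ w x) (fun w => h w x) (by positivity)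
          fun w v => by linarith [hlip w v x]
    _ = _ := (integral_prod _ hZ).symm

end Contraction

/-! ### Sums of independent centred vectors in a Hilbert space. -/

section SecondMoment

variable {Z H : Type*} [MeasurableSpace Z] [NormedAddCommGroup H]

theorem memLp_add_sum_eval {ρ : Measure Z} [IsProbabilityMeasure ρ] {V : Z → H}
    (hV : MemLp V 2 ρ) (m : ℕ) (v : H) :
    MemLp (fun T : Fin m → Z => v + ∑ i, V (T i)) 2 (Measure.pi fun _ => ρ) :=
  (memLp_const v).add (memLp_finsetSum _ fun i _ =>
    hV.comp_measurePreserving (measurePreserving_eval (fun _ : Fin m => ρ) i))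

variable [InnerProductSpace ℝ H]

/-- The second moment of a sum of independent, weakly centred Hilbert space valued variables. -/
theorem integral_norm_add_sum_sq_le {ρ : Measure Z} [IsProbabilityMeasure ρ] {V : Z → H}
    (hV : MemLp V 2 ρ) (h0 : ∀ v, ∫ z, (inner ℝ v (V z) : ℝ) ∂ρ = 0) {s : ℝ}
    (hs : ∫ z, ‖V z‖ ^ 2 ∂ρ ≤ s) (m : ℕ) :
    ∀ v : H, ∫ T : Fin m → Z, ‖v + ∑ i, V (T i)‖ ^ 2 ∂(Measure.pi fun _ => ρ) ≤
      ‖v‖ ^ 2 + m * s := by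
  induction m with
  | zero => intro v; simp [integral_unique, measureReal_def]
  | succ m ih =>
    intro v
    have hi := (memLp_add_sum_eval hV (m + 1) v).integrable_norm_pow (by norm_num)
    have hi' := integrable_comp_finCons hi
    have hVi := hV.integrable_norm_pow (by norm_num)
    have hinn : Integrable (fun z => (inner ℝ v (V z) : ℝ)) ρ :=
      (hV.integrable (by norm_num)).const_inner v
    rw [show ∫ T : Fin (m + 1) → Z, ‖v + ∑ i, V (T i)‖ ^ 2 ∂(Measure.pi fun _ => ρ) = _ from
      integral_pi_succ hi]
    simp only [Fin.sum_univ_succ, Fin.cons_zero, Fin.cons_succ, ← add_assoc] at hi' ⊢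
    -- The first summand is absorbed into the offset `v`; the cross term then integrates to zero by
    -- `h0`.
    have hexp : ∀ z, ‖v + V z‖ ^ 2 + m * s = (‖v‖ ^ 2 + m * s) + 2 * inner ℝ v (V z) + ‖V z‖ ^ 2 :=
      fun z => by rw [norm_add_sq_real]; ring
    have hi2 : Integrable (fun z => (‖v‖ ^ 2 + m * s) + 2 * inner ℝ v (V z)) ρ :=
      (integrable_const _).add (hinn.const_mul 2)
    calc _ ≤ ∫ z, (‖v + V z‖ ^ 2 + m * s) ∂ρ := by
          refine integral_mono hi'.integral_prod_left ?_ fun z => ih (v + V z)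
          simp_rw [hexp]
          exact hi2.add hVi
      _ ≤ ‖v‖ ^ 2 + (m + 1 : ℕ) * s := by
          simp_rw [hexp]
          rw [integral_add hi2 hVi, integral_add (integrable_const _) (hinn.const_mul 2),
            integral_const_mul, h0]
          simp only [integral_const, probReal_univ, one_smul]
          push_cast
          linarith

theorem integral_norm_sum_le {ρ : Measure Z} [IsProbabilityMeasure ρ] {V : Z → H}
    (hV : MemLp V 2 ρ) (h0 : ∀ v, ∫ z, (inner ℝ v (V z) : ℝ) ∂ρ = 0) {r : ℝ} (hr : 0 < r)
    (hs : ∫ z, ‖V z‖ ^ 2 ∂ρ ≤ r ^ 2) {m : ℕ} (hm : 1 ≤ m) :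
    ∫ T : Fin m → Z, ‖∑ i, V (T i)‖ ∂(Measure.pi fun _ => ρ) ≤ √m * r := by
  have hm' : (0 : ℝ) < m := by exact_mod_cast hm
  have hmem : MemLp (fun T : Fin m → Z => ∑ i, V (T i)) 2 (Measure.pi fun _ => ρ) := by
    simpa using memLp_add_sum_eval hV m 0
  have h2 := integral_norm_add_sum_sq_le hV h0 hs m 0
  simp only [zero_add, norm_zero, ne_eq, OfNat.ofNat_ne_zero, not_false_eq_true, zero_pow] at h2
  set a := √m * r with ha
  have hapos : 0 < a := by positivity
  have ha2 : a ^ 2 = m * r ^ 2 := by rw [ha, mul_pow, Real.sq_sqrt hm'.le]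
  have hi2 := hmem.integrable_norm_pow (by norm_num)
  -- The inequality s ≤ s²/(2a) + a/2, tight at s = a = √m · r, passes from the second moment to the
  -- first.
  calc _ ≤ ∫ T : Fin m → Z, (‖∑ i, V (T i)‖ ^ 2 / (2 * a) + a / 2) ∂(Measure.pi fun _ => ρ) := by
        refine integral_mono (hmem.integrable (by norm_num)).norm
          ((hi2.div_const _).add (integrable_const _)) fun T => ?_
        have := sq_nonneg (‖∑ i, V (T i)‖ - a)
        simp only
        rw [← sub_nonneg]
        have e : ‖∑ i, V (T i)‖ ^ 2 / (2 * a) + a / 2 - ‖∑ i, V (T i)‖ =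
          (‖∑ i, V (T i)‖ - a) ^ 2 / (2 * a) := by field_simp; ring
        rw [e]; positivity
    _ = (∫ T : Fin m → Z, ‖∑ i, V (T i)‖ ^ 2 ∂(Measure.pi fun _ => ρ)) / (2 * a) + a / 2 := by
        rw [integral_add (hi2.div_const _) (integrable_const _), integral_div]
        simp
    _ ≤ a ^ 2 / (2 * a) + a / 2 := by rw [ha2]; gcongr
    _ = a := by field_simp; ring

end SecondMoment

/-! ### Gaussian complexity of kernel hypotheses and the tail for finite families. -/

section Complexity

variable {X H : Type*} [NormedAddCommGroup H] [InnerProductSpace ℝ H] {K : ℕ}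

/-- One coordinate of a standard Gaussian vector times an independent feature vector. -/
noncomputable def gaussianFeature (Ξ : X → H) (j : Fin K)
    (z : X × EuclideanSpace ℝ (Fin K)) : H := z.2 j • Ξ z.1

variable {Ξ : X → H} {r : ℝ} {ι : Type*} {W : ι → Fin K → H}
  {h : ι → X → EuclideanSpace ℝ (Fin K)} {Λ : ℝ}

theorem norm_gaussianFeature_sq_le (hr : ∀ x, ‖Ξ x‖ ≤ r) (j : Fin K)
    (z : X × EuclideanSpace ℝ (Fin K)) : ‖gaussianFeature Ξ j z‖ ^ 2 ≤ r ^ 2 * z.2 j ^ 2 := by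
  rw [gaussianFeature, norm_smul, mul_pow, Real.norm_eq_abs, sq_abs, mul_comm]
  gcongr
  exact hr _

theorem inner_eq_sum_inner_gaussianFeature (hW : ∀ w x j, h w x j = inner ℝ (W w j) (Ξ x)) (w : ι)
    (z : X × EuclideanSpace ℝ (Fin K)) :
    inner ℝ z.2 (h w z.1) = ∑ j, inner ℝ (W w j) (gaussianFeature Ξ j z) := by
  rw [PiLp.inner_apply]
  refine Finset.sum_congr rfl fun j _ => ?_
  rw [gaussianFeature, inner_smul_right, hW]
  simp [mul_comm]

variable [MeasurableSpace X] {D : Measure X} [IsProbabilityMeasure D]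

theorem integrable_coord_sq_stdGaussian (j : Fin K) :
    Integrable (fun ξ => ξ j ^ 2) (stdGaussian (EuclideanSpace ℝ (Fin K))) := by
  simpa [EuclideanSpace.inner_single_right] using
    integrable_inner_sq_stdGaussian (EuclideanSpace.single j (1 : ℝ))

theorem integral_coord_sq_stdGaussian (j : Fin K) :
    ∫ ξ, ξ j ^ 2 ∂(stdGaussian (EuclideanSpace ℝ (Fin K))) = 1 := by
  simpa [EuclideanSpace.inner_single_right] using
    integral_inner_sq_stdGaussian (EuclideanSpace.single j (1 : ℝ))

theorem integral_coord_stdGaussian (j : Fin K) :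
    ∫ ξ, ξ j ∂(stdGaussian (EuclideanSpace ℝ (Fin K))) = 0 := by
  simpa [EuclideanSpace.inner_single_right] using
    integral_inner_stdGaussian (EuclideanSpace.single j (1 : ℝ))

theorem memLp_gaussianFeature (hΞ : StronglyMeasurable Ξ) (hr : ∀ x, ‖Ξ x‖ ≤ r) (j : Fin K) :
    MemLp (gaussianFeature Ξ j) 2 (D.prod (stdGaussian (EuclideanSpace ℝ (Fin K)))) := by
  have hsm : AEStronglyMeasurable (gaussianFeature Ξ j)
      (D.prod (stdGaussian (EuclideanSpace ℝ (Fin K)))) := by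
    have h1 : Measurable fun z : X × EuclideanSpace ℝ (Fin K) => z.2 j := by fun_prop
    exact (h1.stronglyMeasurable.smul (hΞ.comp_measurable measurable_fst)).aestronglyMeasurable
  rw [memLp_two_iff_integrable_sq_norm hsm]
  refine Integrable.mono' (((integrable_coord_sq_stdGaussian j).comp_snd D).const_mul (r ^ 2))
    (hsm.norm.pow 2) (Filter.Eventually.of_forall fun z => ?_)
  rw [Real.norm_of_nonneg (by positivity)]
  exact norm_gaussianFeature_sq_le hr j z

/-- The Gaussian coordinate is independent of the feature, with mean 0 and variance 1, so the
product is weakly centred with second moment at most r². -/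
theorem integral_norm_sum_gaussianFeature_le (hΞ : StronglyMeasurable Ξ) (hr0 : 0 < r)
    (hr : ∀ x, ‖Ξ x‖ ≤ r) (j : Fin K) {m : ℕ} (hm : 1 ≤ m) :
    ∫ T : Fin m → X × EuclideanSpace ℝ (Fin K), ‖∑ i, gaussianFeature Ξ j (T i)‖
      ∂(Measure.pi fun _ => D.prod (stdGaussian (EuclideanSpace ℝ (Fin K)))) ≤ √m * r := by
  have hV := memLp_gaussianFeature (D := D) hΞ hr j
  refine integral_norm_sum_le hV (fun v => ?_) hr0 ?_ hm
  · have := integral_prod_mul (μ := D) (ν := stdGaussian (EuclideanSpace ℝ (Fin K)))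
      (fun x => (inner ℝ v (Ξ x) : ℝ)) (fun ξ => ξ j)
    rw [integral_coord_stdGaussian, mul_zero] at this
    rw [← this]
    congr 1; ext z
    rw [gaussianFeature, inner_smul_right, mul_comm]
  · calc _ ≤ ∫ z, r ^ 2 * z.2 j ^ 2 ∂(D.prod (stdGaussian (EuclideanSpace ℝ (Fin K)))) :=
          integral_mono (hV.integrable_norm_pow (by norm_num))
            (((integrable_coord_sq_stdGaussian j).comp_snd D).const_mul (r ^ 2))
            (norm_gaussianFeature_sq_le hr j)
      _ = r ^ 2 := by
          rw [integral_const_mul, integral_fun_snd (fun ξ : EuclideanSpace ℝ (Fin K) => ξ j ^ 2),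
            integral_coord_sq_stdGaussian]
          simp

theorem integrable_inner_gaussian (hΞ : StronglyMeasurable Ξ) (hr : ∀ x, ‖Ξ x‖ ≤ r)
    (hW : ∀ w x j, h w x j = inner ℝ (W w j) (Ξ x)) (w : ι) :
    Integrable (fun z : X × EuclideanSpace ℝ (Fin K) => (inner ℝ z.2 (h w z.1) : ℝ))
      (D.prod (stdGaussian (EuclideanSpace ℝ (Fin K)))) := by
  simp_rw [inner_eq_sum_inner_gaussianFeature hW]
  exact integrable_finsetSum _ fun j _ =>
    ((memLp_gaussianFeature hΞ hr j).integrable (by norm_num)).const_inner _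

/-- The Gaussian complexity of a finite family of vector valued kernel hypotheses. -/
theorem integral_ciSup_gaussian_le [Finite ι] [Nonempty ι] (hΞ : StronglyMeasurable Ξ)
    (hr0 : 0 < r) (hr : ∀ x, ‖Ξ x‖ ≤ r) (hW : ∀ w x j, h w x j = inner ℝ (W w j) (Ξ x))
    (hΛ : ∀ w j, ‖W w j‖ ≤ Λ) {c : ℝ} (hc : 0 ≤ c) {m : ℕ} (hm : 1 ≤ m) :
    ∫ T : Fin m → X × EuclideanSpace ℝ (Fin K),
        ⨆ w, ∑ i, c * inner ℝ (T i).2 (h w (T i).1)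
      ∂(Measure.pi fun _ => D.prod (stdGaussian (EuclideanSpace ℝ (Fin K)))) ≤
      c * (K * (Λ * (√m * r))) := by
  rcases Nat.eq_zero_or_pos K with rfl | hK
  · simp [PiLp.inner_apply]
  have hΛ0 : 0 ≤ Λ := (norm_nonneg _).trans (hΛ (Classical.arbitrary ι) ⟨0, hK⟩)
  have hmem : ∀ j : Fin K, Integrable (fun T : Fin m → X × EuclideanSpace ℝ (Fin K) =>
      Λ * ‖∑ i, gaussianFeature Ξ j (T i)‖)
      (Measure.pi fun _ => D.prod (stdGaussian (EuclideanSpace ℝ (Fin K)))) := fun j => by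
    have := memLp_add_sum_eval (memLp_gaussianFeature (D := D) hΞ hr j) m 0
    simp only [zero_add] at this
    exact (this.integrable (by norm_num)).norm.const_mul _
  have hsum := (integrable_finsetSum Finset.univ fun j _ => hmem j).const_mul c
  calc _ ≤ ∫ T : Fin m → X × EuclideanSpace ℝ (Fin K),
          c * ∑ j : Fin K, Λ * ‖∑ i, gaussianFeature Ξ j (T i)‖
        ∂(Measure.pi fun _ => D.prod (stdGaussian (EuclideanSpace ℝ (Fin K)))) := by
        refine integral_mono (integrable_finite_ciSup fun w => integrable_sum_eval
          ((integrable_inner_gaussian hΞ hr hW w).const_mul c) m) hsum fun T => ?_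
        refine ciSup_le fun w => ?_
        simp_rw [inner_eq_sum_inner_gaussianFeature hW]
        -- Summing over the sample first allows one Cauchy-Schwarz per output coordinate. Only `‖W w
        -- j‖ ≤ Λ` enters, hence the factor `K` whatever the group norm exponent.
        rw [← Finset.mul_sum, Finset.sum_comm]
        gcongr with j
        rw [← inner_sum]
        exact (real_inner_le_norm _ _).trans (by gcongr; exact hΛ w j)
    _ ≤ c * ∑ j : Fin K, Λ * (√m * r) := by
        rw [integral_const_mul, integral_finsetSum _ fun j _ => hmem j]
        gcongr with j
        rw [integral_const_mul]
        gcongr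
        exact integral_norm_sum_gaussianFeature_le hΞ hr0 hr j hm
    _ = _ := by simp

/-- The tail of the uniform deviation over a finite family of losses of kernel hypotheses. -/
theorem measureReal_ciSup_deviation_le [Finite ι] [Nonempty ι] (hΞ : StronglyMeasurable Ξ)
    (hr0 : 0 < r) (hr : ∀ x, ‖Ξ x‖ ≤ r) (hW : ∀ w x j, h w x j = inner ℝ (W w j) (Ξ x))
    (hΛ : ∀ w j, ‖W w j‖ ≤ Λ) {φ : ι → X → ℝ} (hφ : ∀ w, Measurable (φ w)) {C : NNReal}
    (hφC : ∀ w x, φ w x ∈ Set.Icc (0 : ℝ) C) {L : ℝ} (hL : 0 ≤ L)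
    (hlip : ∀ w v x, φ w x - φ v x ≤ L * ‖h w x - h v x‖) {m : ℕ} (hm : 1 ≤ m) {t : ℝ}
    (ht : 0 ≤ t) :
    (Measure.pi fun _ : Fin m => D).real
      {S | √2 * (2 * L) * (K * (Λ * (√m * r))) + t ≤ ⨆ w, ∑ i, (∫ y, φ w y ∂D - φ w (S i))} ≤
      Real.exp (-t ^ 2 / (2 * (m * (C / 2) ^ 2))) := by
  have hφi : ∀ w, Integrable (φ w) D := fun w =>
    Integrable.of_mem_Icc 0 C (hφ w).aemeasurable (Filter.Eventually.of_forall (hφC w))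
  set F : (Fin m → X) → ℝ := fun S => ⨆ w, ∑ i, (∫ y, φ w y ∂D - φ w (S i)) with hF
  have hFm : Measurable F := Measurable.iSup fun w =>
    Finset.measurable_sum _ fun i _ => ((hφ w).comp (measurable_pi_apply i)).const_sub _
  have hdev : ∀ w x, |∫ y, φ w y ∂D - φ w x| ≤ C := by
    intro w x
    have h0 : 0 ≤ ∫ y, φ w y ∂D := integral_nonneg fun y => (hφC w y).1
    have h1 : ∫ y, φ w y ∂D ≤ C := by
      calc _ ≤ ∫ _, (C : ℝ) ∂D := integral_mono (hφi w) (integrable_const _) fun y => (hφC w y).2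
        _ = C := by simp
    have := hφC w x
    rw [abs_le]; constructor <;> linarith [this.1, this.2]
  have hFb : ∀ S, |F S| ≤ m * C := by
    intro S
    obtain ⟨w, hw⟩ := exists_eq_ciSup_of_finite (f := fun w => ∑ i, (∫ y, φ w y ∂D - φ w (S i)))
    simp only [hF]
    rw [← hw]
    calc _ ≤ ∑ i : Fin m, |∫ y, φ w y ∂D - φ w (S i)| := Finset.abs_sum_le_sum_abs _ _
      _ ≤ ∑ i : Fin m, (C : ℝ) := Finset.sum_le_sum fun i _ => hdev w _
      _ = _ := by simp
  have hFd : ∀ S i x y, F (Function.update S i x) - F (Function.update S i y) ≤ C := by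
    intro S i x y
    have hw : ∀ w, ∑ k, (∫ z, φ w z ∂D - φ w (Function.update S i x k)) ≤
        C + ∑ k, (∫ z, φ w z ∂D - φ w (Function.update S i y k)) := by
      intro w
      -- The means cancel, so the difference is φ(y) - φ(x) at the changed coordinate: at most `C`,
      -- not `2 * C`.
      rw [← sub_le_iff_le_add, ← Finset.sum_sub_distrib, Finset.sum_eq_single i]
      · rw [Function.update_self, Function.update_self]
        linarith [(hφC w x).1, (hφC w y).2]
      · intro k _ hk
        rw [Function.update_of_ne hk, Function.update_of_ne hk, sub_self]
      · intro hi
        exact absurd (Finset.mem_univ i) hi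
    have hle : ∀ w, ∑ k, (∫ z, φ w z ∂D - φ w (Function.update S i y k)) ≤
        F (Function.update S i y) := fun w =>
      le_finite_ciSup (fun v => ∑ k, (∫ z, φ v z ∂D - φ v (Function.update S i y k))) w
    have : F (Function.update S i x) ≤ C + F (Function.update S i y) :=
      ciSup_le fun w => (hw w).trans (by linarith [hle w])
    linarith
  have hE : ∫ S, F S ∂(Measure.pi fun _ => D) ≤ √2 * (2 * L) * (K * (Λ * (√m * r))) := by
    have hb : ∀ w, Integrable (fun x => ∫ y, φ w y ∂D - φ w x) D := fun w =>
      (integrable_const _).sub (hφi w)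
    have ha : ∀ w, Integrable (fun z : X × EuclideanSpace ℝ (Fin K) =>
        √2 * (2 * L) * (inner ℝ z.2 (h w z.1) : ℝ))
        (D.prod (stdGaussian (EuclideanSpace ℝ (Fin K)))) := fun w =>
      (integrable_inner_gaussian hΞ hr hW w).const_mul _
    have hstep := integral_ciSup_centred_le hφi hL hlip (integrable_inner_gaussian hΞ hr hW)
    have h1 := integral_ciSup_sum_le hb ha hstep m (fun _ => 0)
    simp only [zero_add] at h1
    exact h1.trans (integral_ciSup_gaussian_le hΞ hr0 hr hW hΛ (by positivity) hm)
  refine le_trans (measureReal_mono ?_)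
    (measureReal_ge_le_of_bounded_differences hFm ⟨_, hFb⟩ hFd ht)
  intro S hS
  have : √2 * (2 * L) * (K * (Λ * (√m * r))) + t ≤ F S := hS
  exact (add_le_add hE le_rfl).trans this

end Complexity

/-! ### From finite to separable families. -/

section Uniform

variable {X H : Type*} [MeasurableSpace X] [NormedAddCommGroup H] [InnerProductSpace ℝ H] {K : ℕ}
  {Ξ : X → H} {D : Measure X} [IsProbabilityMeasure D] {r Λ : ℝ}
  {ι : Type*} {W : ι → Fin K → H} {h : ι → X → EuclideanSpace ℝ (Fin K)}

/-- The tail of the uniform deviation over a separable family of losses of kernel hypotheses. -/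
theorem measure_exists_deviation_le [TopologicalSpace ι] [FirstCountableTopology ι]
    [TopologicalSpace.SeparableSpace ι] [Nonempty ι] (hΞ : StronglyMeasurable Ξ)
    (hr0 : 0 < r) (hr : ∀ x, ‖Ξ x‖ ≤ r) (hW : ∀ w x j, h w x j = inner ℝ (W w j) (Ξ x))
    (hΛ : ∀ w j, ‖W w j‖ ≤ Λ) {φ : ι → X → ℝ} (hφ : ∀ w, Measurable (φ w))
    (hφcont : ∀ x, Continuous fun w => φ w x) {C : NNReal}
    (hφC : ∀ w x, φ w x ∈ Set.Icc (0 : ℝ) C) {L : ℝ} (hL : 0 ≤ L)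
    (hlip : ∀ w v x, φ w x - φ v x ≤ L * ‖h w x - h v x‖) {m : ℕ} (hm : 1 ≤ m) {t : ℝ}
    (ht : 0 ≤ t) :
    (Measure.pi fun _ : Fin m => D)
      {S | ∃ w, √2 * (2 * L) * (K * (Λ * (√m * r))) + t < ∑ i, (∫ y, φ w y ∂D - φ w (S i))} ≤
      ENNReal.ofReal (Real.exp (-t ^ 2 / (2 * (m * (C / 2) ^ 2)))) := by
  set a := √2 * (2 * L) * (K * (Λ * (√m * r))) + t with ha
  set u := TopologicalSpace.denseSeq ι with hu
  set bad : ℕ → Set (Fin m → X) := fun n => {S | a < ∑ i, (∫ y, φ (u n) y ∂D - φ (u n) (S i))}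
    with hbad
  have hint : Continuous fun w => ∫ y, φ w y ∂D :=
    continuous_of_dominated (bound := fun _ => (C : ℝ)) (fun w => (hφ w).aestronglyMeasurable)
      (fun w => Filter.Eventually.of_forall fun x => by
        rw [Real.norm_of_nonneg (hφC w x).1]; exact (hφC w x).2)
      (integrable_const _) (Filter.Eventually.of_forall hφcont)
  have hsub : {S | ∃ w, a < ∑ i, (∫ y, φ w y ∂D - φ w (S i))} ⊆ ⋃ n, bad n := by
    rintro S ⟨w, hw⟩
    have hcont : Continuous fun w => ∑ i, (∫ y, φ w y ∂D - φ w (S i)) :=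
      continuous_finsetSum _ fun i _ => hint.sub (hφcont _)
    -- The strict inequality makes the violating parameters an open set, which the dense sequence
    -- must meet.
    obtain ⟨n, hn⟩ := (TopologicalSpace.denseRange_denseSeq ι).exists_mem_open
      (isOpen_lt continuous_const hcont) ⟨w, hw⟩
    exact Set.mem_iUnion.2 ⟨n, hn⟩
  refine (measure_mono hsub).trans ?_
  -- Continuity from below: the finite-family bound does not depend on the size of the family.
  rw [measure_iUnion_eq_iSup_accumulate]
  refine iSup_le fun n => ?_
  have hfin := measureReal_ciSup_deviation_le (D := D) (ι := Fin (n + 1)) hΞ hr0 hr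
    (W := fun i => W (u i)) (h := fun i => h (u i)) (fun i => hW (u i)) (fun i => hΛ (u i))
    (φ := fun i => φ (u i)) (fun i => hφ (u i)) (fun i => hφC (u i)) hL
    (fun i j => hlip (u i) (u j)) hm ht
  refine le_trans (measure_mono ?_) ((ENNReal.le_ofReal_iff_toReal_le (measure_ne_top _ _)
    (Real.exp_pos _).le).2 hfin)
  intro S hS
  obtain ⟨k, hk, hkS⟩ := Set.mem_accumulate.1 hS
  have hle := le_finite_ciSup (fun i : Fin (n + 1) =>
    ∑ j, (∫ y, φ (u i) y ∂D - φ (u i) (S j))) ⟨k, Nat.lt_succ_of_le hk⟩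
  exact le_trans (le_of_lt hkS) hle

end Uniform

/-! ### Reduction to separable weights. -/

section Weights

variable {E H : Type*} [NormedAddCommGroup H]

theorem groupNorm_zero {K : ℕ} {q : ℝ} (hq : 1 ≤ q) : groupNorm q (0 : Fin K → H) = 0 := by
  have hq0 : q ≠ 0 := by positivity
  simp [groupNorm, hq0]

theorem norm_le_groupNorm {K : ℕ} {q : ℝ} (hq : 1 ≤ q) (w : Fin K → H) (j : Fin K) :
    ‖w j‖ ≤ groupNorm q w := by
  have hq0 : 0 < q := by positivity
  calc ‖w j‖ = (‖w j‖ ^ q) ^ (1 / q) := by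
        rw [← Real.rpow_mul (norm_nonneg _), mul_one_div_cancel hq0.ne', Real.rpow_one]
    _ ≤ _ := by
        refine Real.rpow_le_rpow (by positivity) ?_ (by positivity)
        exact Finset.single_le_sum (f := fun k => ‖w k‖ ^ q) (fun _ _ => by positivity)
          (Finset.mem_univ j)

theorem groupNorm_mono {K : ℕ} {q : ℝ} (hq : 1 ≤ q) {w v : Fin K → H}
    (h : ∀ j, ‖w j‖ ≤ ‖v j‖) : groupNorm q w ≤ groupNorm q v := by
  have hq0 : 0 < q := by positivity
  refine Real.rpow_le_rpow (by positivity) ?_ (by positivity)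
  exact Finset.sum_le_sum fun j _ => Real.rpow_le_rpow (norm_nonneg _) (h j) hq0.le

variable [InnerProductSpace ℝ H] [CompleteSpace H]

/-- If the feature map has separable range, the kernel hypotheses are parametrized by a separable
set of weights. -/
theorem exists_separable_weights {Φ : E → H} (hΦ : TopologicalSpace.IsSeparable (Set.range Φ))
    (K : ℕ) {q Λ : ℝ} (hq : 1 ≤ q) :
    ∃ T : Set (Fin K → H), TopologicalSpace.IsSeparable T ∧ (∀ w ∈ T, groupNorm q w ≤ Λ) ∧
      ∀ g ∈ kernelHypotheses K q Λ Φ, ∃ w ∈ T, ∀ x j, g x j = inner ℝ (w j) (Φ x) := by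
  set U : Submodule ℝ H := (Submodule.span ℝ (Set.range Φ)).topologicalClosure with hU
  have hUsep : TopologicalSpace.IsSeparable (U : Set H) := by
    rw [hU, Submodule.topologicalClosure_coe]
    exact (hΦ.span (R := ℝ)).closure
  have hUc : IsClosed (U : Set H) := Submodule.isClosed_topologicalClosure _
  have : CompleteSpace U := hUc.completeSpace_coe
  have hΦU : ∀ x, Φ x ∈ U := fun x =>
    Submodule.le_topologicalClosure _ (Submodule.subset_span ⟨x, rfl⟩)
  refine ⟨{w | (∀ j, w j ∈ U) ∧ groupNorm q w ≤ Λ}, ?_, fun w hw => hw.2, ?_⟩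
  · have := TopologicalSpace.IsSeparable.univ_pi (fun _ : Fin K => hUsep)
    exact this.mono fun w hw j _ => hw.1 j
  · rintro g ⟨w, hw, hg⟩
    -- Projecting onto the closed span of the features changes no value ⟨w j, Φ x⟩ and increases no
    -- norm.
    refine ⟨fun j => U.starProjection (w j), ⟨fun j => ?_, ?_⟩, fun x j => ?_⟩
    · exact Submodule.starProjection_apply_mem _ _
    · exact (groupNorm_mono hq fun j => U.norm_starProjection_apply_le (w j)).trans hw
    · rw [hg, Submodule.inner_starProjection_left_eq_right,
        Submodule.starProjection_eq_self_iff.2 (hΦU x)]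

end Weights

end MCIMO

/-! ### Assembly of the generalization bound. -/

theorem theorem3
    {d K m : ℕ} (hm : 1 ≤ m)
    -- the input space and the fuzzy distribution over it
    (𝒳 : Set (MCIMO.FuzzyVector d)) (D : MeasureTheory.Measure 𝒳)
    [MeasureTheory.IsProbabilityMeasure D]
    -- the ground truth labelling
    (f : 𝒳 → Fin K) (hf : Measurable f)
    -- the defuzzification function
    (M : 𝒳 → EuclideanSpace ℝ (Fin d)) (hM : Measurable M)
    -- the PDS kernel with a feature map
    {H : Type*} [NormedAddCommGroup H] [InnerProductSpace ℝ H] [CompleteSpace H]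
    (k : EuclideanSpace ℝ (Fin d) → EuclideanSpace ℝ (Fin d) → ℝ) (hk : MCIMO.IsPDSKernel k)
    (Φ : EuclideanSpace ℝ (Fin d) → H) (hΦ : MCIMO.IsFeatureMap k Φ)
    (hΦ_meas : MeasureTheory.StronglyMeasurable Φ)
    (r : ℝ) (hr : 0 < r) (hkr : ∀ x : 𝒳, k (M x) (M x) ≤ r ^ 2)
    -- the exponent of the group norm and the bound on the weights
    (q : ℝ) (hq : 1 ≤ q) (Λ : ℝ) (hΛ : 0 ≤ Λ)
    -- the loss function
    (l : EuclideanSpace ℝ (Fin K) → Fin K → ℝ) (hl_nonneg : ∀ t y, 0 ≤ l t y)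
    (C C_l : ℝ) (hC : 0 < C) (hC_l : 0 < C_l) (L_l : NNReal)
    (hgC : ∀ g ∈ MCIMO.kernelHypotheses K q Λ Φ, ∀ (x : 𝒳) (j : Fin K), |g (M x) j| ≤ C)
    (hlC : ∀ t : EuclideanSpace ℝ (Fin K), (∀ j, |t j| ≤ C) → ∀ y, l t y ≤ C_l)
    (hlL : ∀ y, LipschitzOnWith L_l (fun t => l t y) {t | ∀ j, |t j| ≤ C})
    -- the confidence parameter and the error bound
    (δ : ℝ) (hδ : 0 < δ) (B : ℝ)
    (hB : B = 2 * K * L_l * √(2 * r ^ 2 * Λ ^ 2 / m) + C_l * √(2 * Real.log (1 / δ) / m)) :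
    (2 * δ ^ 3 ≤ 1 →
      1 - δ ≤ MCIMO.fuzzyProb D m {S | ∀ g ∈ MCIMO.kernelHypotheses K q Λ Φ,
        |MCIMO.risk D l f (g ∘ M) - MCIMO.empiricalRisk l f S (g ∘ M)| ≤ B}) ∧
    1 - δ ≤ MCIMO.fuzzyProb D m {S | ∀ g ∈ MCIMO.kernelHypotheses K q Λ Φ,
      MCIMO.risk D l f (g ∘ M) - MCIMO.empiricalRisk l f S (g ∘ M) ≤ B} ∧
    1 - δ ≤ MCIMO.fuzzyProb D m {S | ∀ g ∈ MCIMO.kernelHypotheses K q Λ Φ,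
      MCIMO.empiricalRisk l f S (g ∘ M) - MCIMO.risk D l f (g ∘ M) ≤ B} := by
  have hm0 : (0 : ℝ) < m := by exact_mod_cast hm
  rcases le_or_gt 1 δ with hδ1 | hδ1
  · have hnn : ∀ A : Set (Fin m → 𝒳), 1 - δ ≤ MCIMO.fuzzyProb D m A := fun A =>
      (sub_nonpos.2 hδ1).trans MeasureTheory.measureReal_nonneg
    exact ⟨fun _ => hnn _, hnn _, hnn _⟩
  have hΞ : MeasureTheory.StronglyMeasurable fun x : 𝒳 => Φ (M x) := hΦ_meas.comp_measurable hM
  have hΞr : ∀ x : 𝒳, ‖Φ (M x)‖ ≤ r := fun x => by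
    refine le_of_sq_le_sq ?_ hr.le
    rw [← real_inner_self_eq_norm_sq, hΦ]
    exact hkr x
  obtain ⟨T, hTsep, hTΛ, hT⟩ := MCIMO.exists_separable_weights (Λ := Λ)
    hΦ_meas.isSeparable_range K hq
  have hTmem : ∀ w ∈ T, (fun x => WithLp.toLp 2 fun j => (inner ℝ (w j) (Φ x) : ℝ)) ∈
      MCIMO.kernelHypotheses K q Λ Φ := fun w hw => ⟨w, hTΛ w hw, fun x j => rfl⟩
  have : Nonempty T := by
    obtain ⟨w, hw, -⟩ := hT 0 ⟨0, by rwa [MCIMO.groupNorm_zero hq], by simp⟩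
    exact ⟨w, hw⟩
  have : TopologicalSpace.SeparableSpace T := hTsep.separableSpace
  set h : T → 𝒳 → EuclideanSpace ℝ (Fin K) :=
    fun w x => WithLp.toLp 2 fun j => (inner ℝ (w.1 j) (Φ (M x)) : ℝ) with hh
  have hbox : ∀ w x, h w x ∈ {t : EuclideanSpace ℝ (Fin K) | ∀ j, |t j| ≤ C} := fun w x =>
    hgC _ (hTmem w.1 w.2) x
  -- The loss is regular only on the box, where all hypothesis values lie. A global Lipschitz
  -- extension supplies measurability in `x` and continuity in the weights.
  choose ψ hψL hψ using fun y => (hlL y).extend_real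
  set φ : T → 𝒳 → ℝ := fun w x => l (h w x) (f x) with hφ
  have hφψ : ∀ w x, φ w x = ψ (f x) (h w x) := fun w x => hψ (f x) (hbox w x)
  have hφmeas : ∀ w, Measurable (φ w) := fun w => by
    have h1 : Measurable fun p : EuclideanSpace ℝ (Fin K) × Fin K => ψ p.2 p.1 :=
      measurable_from_prod_countable_left fun y => (hψL y).continuous.measurable
    have h2 : Measurable (h w) := by
      refine (WithLp.measurable_toLp 2 _).comp (measurable_pi_lambda _ fun j => ?_)
      exact (MeasureTheory.stronglyMeasurable_const.inner hΞ).measurable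
    have h3 : φ w = fun x => ψ (f x) (h w x) := funext (hφψ w)
    rw [h3]
    exact h1.comp (h2.prodMk hf)
  have hφcont : ∀ x, Continuous fun w => φ w x := fun x => by
    simp_rw [hφψ]
    refine (hψL (f x)).continuous.comp ?_
    refine (PiLp.continuous_toLp 2 _).comp (continuous_pi fun j => ?_)
    exact ((continuous_apply j).comp continuous_subtype_val).inner continuous_const
  have hφC : ∀ w x, φ w x ∈ Set.Icc (0 : ℝ) C_l := fun w x =>
    ⟨hl_nonneg _ _, hlC _ (hbox w x) _⟩
  have hlip : ∀ w v x, φ w x - φ v x ≤ L_l * ‖h w x - h v x‖ := fun w v x => by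
    rw [hφψ, hφψ, ← dist_eq_norm]
    exact (le_abs_self _).trans ((hψL (f x)).dist_le_mul _ _)
  have hWΛ : ∀ (w : T) j, ‖w.1 j‖ ≤ Λ := fun w j =>
    (MCIMO.norm_le_groupNorm hq w.1 j).trans (hTΛ w.1 w.2)
  set t : ℝ := m * (C_l * √(2 * Real.log (1 / δ) / m)) with ht
  have ht0 : 0 ≤ t := by positivity
  have hlog : 0 ≤ Real.log (1 / δ) := Real.log_nonneg (by rw [le_div_iff₀ hδ]; linarith)
  -- The exponent is -2t²/(m C_l²) = -4 log(1/δ).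
  have hexp : Real.exp (-t ^ 2 / (2 * (m * (C_l / 2) ^ 2))) = δ ^ 4 := by
    have h1 : -t ^ 2 / (2 * (m * (C_l / 2) ^ 2)) = (4 : ℕ) * Real.log δ := by
      rw [ht, mul_pow, mul_pow, Real.sq_sqrt (by positivity), one_div, Real.log_inv]
      push_cast
      field_simp
      ring
    rw [h1, Real.exp_nat_mul, Real.exp_log hδ]
  have hmB : √2 * (2 * L_l) * (K * (Λ * (√m * r))) + t = m * B := by
    have h1 : √(2 * r ^ 2 * Λ ^ 2 / m) = √2 * r * Λ / √m := by
      rw [Real.sqrt_div (by positivity), Real.sqrt_mul (by positivity),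
        Real.sqrt_mul (by positivity), Real.sqrt_sq hr.le, Real.sqrt_sq hΛ]
    have h2 : (m : ℝ) / √m = √m := Real.div_sqrt
    rw [hB, h1, ht, mul_add]
    congr 1
    calc _ = 2 * K * L_l * (√2 * r * Λ) * √m := by ring
      _ = 2 * K * L_l * (√2 * r * Λ) * (m / √m) := by rw [h2]
      _ = _ := by ring
  lift C_l to NNReal using hC_l.le
  have hup := MCIMO.measure_exists_deviation_le (D := D) hΞ hr hΞr
    (W := fun w : T => w.1) (h := h) (fun w x j => rfl) hWΛ hφmeas hφcont hφC
    L_l.coe_nonneg hlip hm ht0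
  -- The reverse deviation is the same bound for the reflected loss `C_l - φ`, which has the same
  -- range and Lipschitz constant.
  have hdown := MCIMO.measure_exists_deviation_le (D := D) hΞ hr hΞr
    (W := fun w : T => w.1) (h := h) (fun w x j => rfl) hWΛ (φ := fun w x => C_l - φ w x)
    (fun w => (hφmeas w).const_sub _) (fun x => continuous_const.sub (hφcont x))
    (fun w x => ⟨sub_nonneg.2 (hφC w x).2, sub_le_self _ (hφC w x).1⟩)
    L_l.coe_nonneg
    (fun w v x => by
      have := hlip v w x
      rw [norm_sub_rev] at this
      linarith) hm ht0
  have hφi : ∀ w, MeasureTheory.Integrable (φ w) D := fun w =>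
    MeasureTheory.Integrable.of_mem_Icc 0 C_l (hφmeas w).aemeasurable
      (Filter.Eventually.of_forall (hφC w))
  have hdev : ∀ g ∈ MCIMO.kernelHypotheses K q Λ Φ, ∃ w : T, ∀ S : Fin m → 𝒳,
      ∑ i, (∫ y, φ w y ∂D - φ w (S i)) =
        m * (MCIMO.risk D l f (g ∘ M) - MCIMO.empiricalRisk l f S (g ∘ M)) := by
    intro g hg
    obtain ⟨w, hw, hgw⟩ := hT g hg
    have hgh : g ∘ M = h ⟨w, hw⟩ := by
      ext x j
      exact hgw (M x) j
    refine ⟨⟨w, hw⟩, fun S => ?_⟩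
    rw [hgh, MCIMO.risk, MCIMO.empiricalRisk, Finset.sum_sub_distrib]
    simp only [Finset.sum_const, Finset.card_univ, Fintype.card_fin, nsmul_eq_mul, hφ]
    field_simp
  simp only [hexp, hmB] at hup hdown
  set U : Set (Fin m → 𝒳) := {S | ∃ w, m * B < ∑ i, (∫ y, φ w y ∂D - φ w (S i))} with hU
  set V : Set (Fin m → 𝒳) := {S | ∃ w, m * B < ∑ i, (∫ y, ((C_l : ℝ) - φ w y) ∂D -
    ((C_l : ℝ) - φ w (S i)))} with hV
  have hUr : (MeasureTheory.Measure.pi fun _ : Fin m => D).real U ≤ δ ^ 4 :=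
    ENNReal.toReal_le_of_le_ofReal (by positivity) hup
  have hVr : (MeasureTheory.Measure.pi fun _ : Fin m => D).real V ≤ δ ^ 4 :=
    ENNReal.toReal_le_of_le_ofReal (by positivity) hdown
  have hUgood : ∀ S ∉ U, ∀ g ∈ MCIMO.kernelHypotheses K q Λ Φ,
      MCIMO.risk D l f (g ∘ M) - MCIMO.empiricalRisk l f S (g ∘ M) ≤ B := by
    intro S hS g hg
    obtain ⟨w, hw⟩ := hdev g hg
    by_contra! hlt
    exact hS ⟨w, by rw [hw S]; gcongr⟩
  have hVgood : ∀ S ∉ V, ∀ g ∈ MCIMO.kernelHypotheses K q Λ Φ,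
      MCIMO.empiricalRisk l f S (g ∘ M) - MCIMO.risk D l f (g ∘ M) ≤ B := by
    intro S hS g hg
    obtain ⟨w, hw⟩ := hdev g hg
    by_contra! hlt
    refine hS ⟨w, ?_⟩
    have h1 : ∑ i, (∫ y, ((C_l : ℝ) - φ w y) ∂D - ((C_l : ℝ) - φ w (S i))) =
        -∑ i, (∫ y, φ w y ∂D - φ w (S i)) := by
      rw [MeasureTheory.integral_sub (MeasureTheory.integrable_const _) (hφi w),
        ← Finset.sum_neg_distrib]
      simp only [MeasureTheory.integral_const, MeasureTheory.probReal_univ, one_smul]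
      exact Finset.sum_congr rfl fun i _ => by ring
    rw [h1, hw S, ← mul_neg, neg_sub]
    gcongr
  have hcompl : ∀ {A G : Set (Fin m → 𝒳)} {p : ℝ},
      (MeasureTheory.Measure.pi fun _ : Fin m => D).real A ≤ p → p ≤ δ → Aᶜ ⊆ G →
      1 - δ ≤ MCIMO.fuzzyProb D m G := by
    intro A G p hA hp hAG
    -- Subadditivity suffices here, so the events need not be measurable.
    have h1 := MeasureTheory.measureReal_union_le (μ := MeasureTheory.Measure.pi fun _ : Fin m => D)
      A Aᶜ
    rw [Set.union_compl_self, MeasureTheory.probReal_univ] at h1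
    have h2 : _ ≤ MCIMO.fuzzyProb D m G := MeasureTheory.measureReal_mono hAG
    linarith
  have hδ4 : δ ^ 4 ≤ δ := pow_le_of_le_one hδ.le hδ1.le (by norm_num)
  refine ⟨fun hδ3 => ?_, hcompl hUr hδ4 hUgood, hcompl hVr hδ4 hVgood⟩
  refine hcompl (A := U ∪ V) (p := 2 * δ ^ 4) ?_ ?_ fun S hS g hg => ?_
  · exact (MeasureTheory.measureReal_union_le U V).trans (by linarith)
  · have := mul_le_mul_of_nonneg_left hδ3 hδ.le
    linarith
  · rw [Set.compl_union] at hS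
    refine abs_le.2 ⟨?_, hUgood S hS.1 g hg⟩
    linarith [hVgood S hS.2 g hg]
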